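/- Let $\mathbb{B}$ be a countable set with its discrete $\sigma$-algebra, and consider stationary processes $\xi=(\xi_n)_{n\in\mathbb{Z}}$ with values in $\mathbb{B}$, each defined on some probability space. The entropy $h(\xi)\in[0,\infty]$ is the Kolmogorov--Sinai entropy of the shift on $\mathbb{B}^{\mathbb{Z}}$ with respect to the law of $\xi$, that is, the supremum of the entropies of the shift with respect to all finite measurable partitions of $\mathbb{B}^{\mathbb{Z}}$. For two such processes $\xi,\zeta$, let $$\bar d(\xi,\zeta):=\sup_{L\ge 1}\ \inf_{\lambda}\ \int \frac1L\,\#\{1\le i\le L:\ x_i\ne z_i\}\,d\lambda(x,z),$$ where $\lambda$ ranges over all probability distributions on $\mathbb{B}^L\times\mathbb{B}^L$ whose marginals are the distributions of $(\xi_1,\dots,\xi_L)$ and $(\zeta_1,\dots,\zeta_L)$. Let $\xi$ be a stationary process with values in $\mathbb{B}$ such that $h(\xi)<\infty$. Then for every $\varepsilon>0$ there exists $\delta>0$ such that every stationary process $\zeta$ with values in $\mathbb{B}$ and $\bar d(\xi,\zeta)<\delta$ satisfies $h(\zeta)>h(\xi)-\varepsilon$. -/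

import Mathlib

open MeasureTheory Filter
open scoped ENNReal

noncomputable section

namespace StationaryProcess

/-- The law, on the path space, of the process `X` under the measure `P`. -/
def law {Ω B : Type*} [MeasurableSpace Ω] [MeasurableSpace B] (P : Measure Ω)
    (X : ℤ → Ω → B) : Measure (ℤ → B) :=
  P.map (fun ω n => X n ω)

/-- A (measurable) process indexed by the integers is stationary if its law is invariant under
all translations of time. -/
def IsStationary {Ω B : Type*} [MeasurableSpace Ω] [MeasurableSpace B] (P : Measure Ω)
    (X : ℤ → Ω → B) : Prop :=
  (∀ n, Measurable (X n)) ∧ ∀ k : ℤ, law P (fun n => X (n + k)) = law P X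

/-- The distribution of the finite sequence `(X 1, …, X L)`. -/
def blockLaw {Ω B : Type*} [MeasurableSpace Ω] [MeasurableSpace B] (P : Measure Ω)
    (X : ℤ → Ω → B) (L : ℕ) : Measure (Fin L → B) :=
  P.map (fun ω (i : Fin L) => X ((i : ℤ) + 1) ω)

/-- The joinings of two distributions: the measures on the product with these marginals.
(A joining of two probability measures is itself a probability measure.) -/
def joinings {S T : Type*} [MeasurableSpace S] [MeasurableSpace T] (μ : Measure S)
    (ν : Measure T) : Set (Measure (S × T)) :=
  {m | m.map Prod.fst = μ ∧ m.map Prod.snd = ν}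

open Classical in
/-- The normalized Hamming distance between two words of length `L`: the proportion of the
positions at which they differ. -/
def hamming {B : Type*} {L : ℕ} (x z : Fin L → B) : ℝ≥0∞ :=
  (hammingDist x z : ℝ≥0∞) / (L : ℝ≥0∞)

/-- The distance `d̄_L` between two processes: the least expected normalized Hamming distance
over all joinings of the two distributions of words of length `L`. -/
def dbarBlock {Ω Ω' B : Type*} [MeasurableSpace Ω] [MeasurableSpace Ω'] [MeasurableSpace B]
    (P : Measure Ω) (X : ℤ → Ω → B) (P' : Measure Ω') (Y : ℤ → Ω' → B) (L : ℕ) : ℝ≥0∞ :=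
  ⨅ m ∈ joinings (blockLaw P X L) (blockLaw P' Y L), ∫⁻ p, hamming p.1 p.2 ∂m

/-- The distance `d̄` between two processes: the supremum of `d̄_L` over `L ≥ 1`. -/
def dbar {Ω Ω' B : Type*} [MeasurableSpace Ω] [MeasurableSpace Ω'] [MeasurableSpace B]
    (P : Measure Ω) (X : ℤ → Ω → B) (P' : Measure Ω') (Y : ℤ → Ω' → B) : ℝ≥0∞ :=
  ⨆ (L : ℕ) (_ : 1 ≤ L), dbarBlock P X P' Y L

/-- The Shannon entropy (natural logarithm) of the finite partition of `S` into the level sets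
of `f`. -/
def shannonEntropy {S A : Type*} [MeasurableSpace S] [Fintype A] (μ : Measure S)
    (f : S → A) : ℝ :=
  ∑ a, Real.negMulLog (μ.real (f ⁻¹' {a}))

/-- The entropy `h(T, f) = lim H(f ∨ f ∘ T ∨ ⋯ ∨ f ∘ T^(n-1)) / n` of the finite partition
into the level sets of `f`, with respect to the transformation `T`. For a measure-preserving
`T` the limit exists by subadditivity, so that the upper limit below is this limit. -/
def partitionEntropy {S A : Type*} [MeasurableSpace S] [Fintype A] (μ : Measure S)
    (T : S → S) (f : S → A) : ℝ≥0∞ :=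
  limsup (fun n : ℕ =>
    ENNReal.ofReal (shannonEntropy μ (fun x (i : Fin n) => f (T^[i] x)) / n)) atTop

/-- The Kolmogorov–Sinai entropy of `T`: the supremum of `h(T, f)` over all finite measurable
partitions, a partition being given by a measurable labelling of its cells. -/
def kolmogorovSinaiEntropy {S : Type*} [MeasurableSpace S] (μ : Measure S) (T : S → S) :
    ℝ≥0∞ :=
  ⨆ (k : ℕ) (f : S → Fin k) (_ : Measurable f), partitionEntropy μ T f

/-- The shift on the path space. -/
def shift {B : Type*} (x : ℤ → B) : ℤ → B := fun n => x (n + 1)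

/-- The entropy of a process: the Kolmogorov–Sinai entropy of the shift with respect to the
law of the process. -/
def entropy {Ω B : Type*} [MeasurableSpace Ω] [MeasurableSpace B] (P : Measure Ω)
    (X : ℤ → Ω → B) : ℝ≥0∞ :=
  kolmogorovSinaiEntropy (law P X) shift

end StationaryProcess

end

/-! Only one bound is needed: some finite partition of the path space must keep almost all of
`entropy P ξ` and have an entropy that moves little under `dbar`. Since `entropy P ξ` is finite, a
finite partition `f` nearly attains the supremum. Up to a shift, `f` agrees off a small set with a
partition by words of a fixed length `M` (`exists_wordPartition_approx`). For the word partition, a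
joining of long blocks with few expected mismatches induces one of the label sequences, each letter
mismatch spoiling at most `M` labels (`sum_slidingCode_ne_le`).

Both approximations rest on `shannonEntropy_le_add`: a random word can be described from a coupled
one by listing corrections, at a cost per letter of `noiseCost` plus `c` times the mismatch
frequency. Fix `c` large to make the first term small, then make the frequency small compared with
`1 / c`. The alphabet of labels is finite even when `B` is infinite. -/

namespace StationaryProcess

/-! ### Entropy of coupled random words -/

/-- Gibbs' inequality in conditional form: the entropy of the first marginal exceeds that of the
second by at most the cost of describing the first coordinate by means of the second through the
subprobability kernel `w`. -/
theorem sum_negMulLog_le_of_kernel {α β : Type*} [Fintype α] [Fintype β] (p w : α → β → ℝ)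
    (hp : ∀ a b, 0 ≤ p a b) (hw : ∀ a b, 0 < w a b) (hw1 : ∀ b, ∑ a, w a b ≤ 1) :
    ∑ a, Real.negMulLog (∑ b, p a b) ≤
      ∑ b, Real.negMulLog (∑ a, p a b) + ∑ a, ∑ b, p a b * (-Real.log (w a b)) := by
  -- Combine `p a b ≤ ∑ b', p a b'` with `log t ≤ t - 1` at `t = (∑ a', p a' b) * w a b / p a b`;
  -- the last bracket has nonpositive total because `w` is subprobability.
  have key : ∀ a b, -(p a b) * Real.log (∑ b', p a b') ≤
      -(p a b) * Real.log (∑ a', p a' b) + p a b * (-Real.log (w a b)) +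
        ((∑ a', p a' b) * w a b - p a b) := by
    intro a b
    have hB : p a b ≤ ∑ a', p a' b :=
      Finset.single_le_sum (f := fun a' => p a' b) (fun a' _ => hp a' b) (Finset.mem_univ a)
    have hA : p a b ≤ ∑ b', p a b' :=
      Finset.single_le_sum (f := fun b' => p a b') (fun b' _ => hp a b') (Finset.mem_univ b)
    rcases (hp a b).eq_or_lt with h0 | h0
    · rw [← h0] at hB ⊢
      have := mul_nonneg hB (hw a b).le
      simpa using this
    · have hB0 := h0.trans_le hB
      have h1 : Real.log (p a b) ≤ Real.log (∑ b', p a b') := Real.log_le_log h0 hA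
      have h2 := Real.log_le_sub_one_of_pos (div_pos (mul_pos hB0 (hw a b)) h0)
      rw [Real.log_div (mul_pos hB0 (hw a b)).ne' h0.ne', Real.log_mul hB0.ne' (hw a b).ne'] at h2
      have h3 := mul_le_mul_of_nonneg_left h2 h0.le
      have h4 := mul_le_mul_of_nonneg_left h1 h0.le
      have h5 : p a b * ((∑ a', p a' b) * w a b / p a b - 1) =
          (∑ a', p a' b) * w a b - p a b := by
        field_simp
      rw [h5] at h3
      nlinarith
  have hsum := Finset.sum_le_sum fun a (_ : a ∈ Finset.univ) =>
    Finset.sum_le_sum fun b (_ : b ∈ Finset.univ) => key a b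
  have e1 : ∑ a, ∑ b, -(p a b) * Real.log (∑ b', p a b') =
      ∑ a, Real.negMulLog (∑ b, p a b) := by
    refine Finset.sum_congr rfl fun a _ => ?_
    rw [← Finset.sum_mul, Finset.sum_neg_distrib, Real.negMulLog]
  have e2 : ∑ a, ∑ b, -(p a b) * Real.log (∑ a', p a' b) =
      ∑ b, Real.negMulLog (∑ a, p a b) := by
    rw [Finset.sum_comm]
    refine Finset.sum_congr rfl fun b _ => ?_
    rw [← Finset.sum_mul, Finset.sum_neg_distrib, Real.negMulLog]
  have e3 : ∑ a, ∑ b, ((∑ a', p a' b) * w a b - p a b) ≤ 0 := by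
    rw [Finset.sum_comm]
    refine Finset.sum_nonpos fun b _ => ?_
    rw [Finset.sum_sub_distrib, ← Finset.mul_sum]
    have := mul_le_mul_of_nonneg_left (hw1 b) (Finset.sum_nonneg fun a (_ : a ∈ Finset.univ) => hp a b)
    linarith
  simp only [Finset.sum_add_distrib] at hsum
  linarith

/-- The logarithmic normalizing constant of the noise kernel on `k` letters that charges the price
`c` for a wrong letter. -/
noncomputable def noiseCost (k : ℕ) (c : ℝ) : ℝ := Real.log (1 + k * Real.exp (-c))

theorem tendsto_noiseCost (k : ℕ) : Tendsto (noiseCost k) atTop (nhds 0) := by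
  have h : Tendsto (fun c : ℝ => 1 + (k : ℝ) * Real.exp (-c)) atTop (nhds (1 + k * 0)) :=
    (Real.tendsto_exp_neg_atTop_nhds_zero.const_mul _).const_add _
  have h2 := h.log (by simp)
  rw [mul_zero, add_zero, Real.log_one] at h2
  exact h2

open Classical in
/-- Entropy of a random word compared with that of another one over the same alphabet. -/
theorem shannonEntropy_le_add {S A : Type*} [MeasurableSpace S] [Fintype A] [MeasurableSpace A]
    [MeasurableSingletonClass A] (m : Measure S) [IsProbabilityMeasure m] {L : ℕ}
    {U V : S → Fin L → A} (hU : Measurable U) (hV : Measurable V) (c : ℝ) :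
    shannonEntropy m U ≤ shannonEntropy m V + L * noiseCost (Fintype.card A) c +
      c * ∑ i, m.real {s | U s i ≠ V s i} := by
  set Z : ℝ := 1 + Fintype.card A * Real.exp (-c) with hZ
  have hZ0 : 0 < Z := by positivity
  have hUV : Measurable fun s => (U s, V s) := hU.prodMk hV
  have hfib : ∀ T : Finset ((Fin L → A) × (Fin L → A)),
      ∑ q ∈ T, m.real ((fun s => (U s, V s)) ⁻¹' {q}) = m.real ((fun s => (U s, V s)) ⁻¹' T) :=
    fun T => sum_measureReal_preimage_singleton T fun q _ => hUV (measurableSet_singleton q)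
  set p : (Fin L → A) → (Fin L → A) → ℝ :=
    fun u v => m.real ((fun s => (U s, V s)) ⁻¹' {(u, v)}) with hp
  -- Independent noise on each letter. `Z` counts all letters as wrong ones in addition to the right
  -- one, so the weights sum to at most 1, and `-log w` is affine in the number of mismatches.
  set w : (Fin L → A) → (Fin L → A) → ℝ :=
    fun u v => ∏ i, (if u i = v i then 1 else Real.exp (-c)) / Z with hw
  have hlet : ∀ a b : A, 0 < (if a = b then 1 else Real.exp (-c)) / Z := fun a b => by
    split_ifs <;> positivity
  have hpU : ∀ u, ∑ v, p u v = m.real (U ⁻¹' {u}) := by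
    intro u
    have := hfib ({u} ×ˢ Finset.univ)
    rw [Finset.sum_product, Finset.sum_singleton] at this
    rw [this]
    congr 1
    ext s
    simp [eq_comm]
  have hpV : ∀ v, ∑ u, p u v = m.real (V ⁻¹' {v}) := by
    intro v
    have := hfib (Finset.univ ×ˢ {v})
    simp only [Finset.sum_product, Finset.sum_singleton] at this
    rw [this]
    congr 1
    ext s
    simp [eq_comm]
  have hw1 : ∀ v, ∑ u, w u v ≤ 1 := by
    intro v
    have h := Finset.prod_univ_sum (fun _ : Fin L => (Finset.univ : Finset A))
      (fun i a => (if a = v i then 1 else Real.exp (-c)) / Z)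
    rw [Fintype.piFinset_univ] at h
    rw [hw, ← h]
    refine Finset.prod_le_one (fun i _ => Finset.sum_nonneg fun a _ => (hlet a _).le) fun i _ => ?_
    rw [← Finset.sum_div, div_le_one hZ0, hZ]
    calc ∑ a, (if a = v i then 1 else Real.exp (-c))
        ≤ ∑ a, ((if a = v i then 1 else 0) + Real.exp (-c)) := by
          refine Finset.sum_le_sum fun a _ => ?_
          split_ifs
          · linarith [Real.exp_pos (-c)]
          · simp
      _ = _ := by simp [Finset.sum_add_distrib]
  have hlog : ∀ u v, -Real.log (w u v) =
      L * noiseCost (Fintype.card A) c + c * ∑ i, if u i = v i then 0 else 1 := by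
    intro u v
    rw [hw, Real.log_prod fun i _ => (hlet _ _).ne', Finset.mul_sum, ← Finset.sum_neg_distrib]
    have : (L : ℝ) * noiseCost (Fintype.card A) c =
        ∑ i : Fin L, noiseCost (Fintype.card A) c := by simp
    rw [this, ← Finset.sum_add_distrib]
    refine Finset.sum_congr rfl fun i _ => ?_
    rw [noiseCost, ← hZ]
    split_ifs
    · simp
    · rw [Real.log_div (Real.exp_pos _).ne' hZ0.ne', Real.log_exp]
      ring
  have hmain := sum_negMulLog_le_of_kernel p w (fun _ _ => measureReal_nonneg)
    (fun u v => Finset.prod_pos fun i _ => hlet _ _) hw1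
  simp only [hpU, hpV, hlog] at hmain
  have htot : ∑ u, ∑ v, p u v = 1 := by
    have := hfib Finset.univ
    rw [← Finset.univ_product_univ, Finset.sum_product] at this
    rw [this]
    simp
  have hmis : ∀ i, ∑ u, ∑ v, p u v * (if u i = v i then 0 else 1) =
      m.real {s | U s i ≠ V s i} := by
    intro i
    have := hfib (Finset.univ.filter fun q => q.1 i ≠ q.2 i)
    rw [Finset.sum_filter, ← Finset.univ_product_univ, Finset.sum_product] at this
    have h2 : ((fun s => (U s, V s)) ⁻¹'
        ↑(((Finset.univ : Finset (Fin L → A)) ×ˢ (Finset.univ : Finset (Fin L → A))).filter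
          fun q => q.1 i ≠ q.2 i)) = {s | U s i ≠ V s i} := by
      ext s
      simp
    rw [h2] at this
    rw [← this]
    refine Finset.sum_congr rfl fun u _ => Finset.sum_congr rfl fun v _ => ?_
    by_cases h : u i = v i <;> simp [h, hp]
  have hcost : ∑ u, ∑ v, p u v *
      (L * noiseCost (Fintype.card A) c + c * ∑ i, if u i = v i then (0 : ℝ) else 1) =
      L * noiseCost (Fintype.card A) c + c * ∑ i, m.real {s | U s i ≠ V s i} := by
    simp_rw [← hmis, mul_add, Finset.sum_add_distrib, ← Finset.sum_mul, htot, one_mul]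
    congr 1
    simp_rw [Finset.mul_sum]
    conv_rhs => rw [Finset.sum_comm]
    refine Finset.sum_congr rfl fun u _ => ?_
    rw [Finset.sum_comm]
    refine Finset.sum_congr rfl fun i _ => Finset.sum_congr rfl fun v _ => ?_
    ring
  rw [hcost] at hmain
  unfold shannonEntropy
  linarith

/-! ### Entropy of partitions under a measure-preserving map -/

theorem shannonEntropy_map {S S' A : Type*} [MeasurableSpace S] [MeasurableSpace S'] [Fintype A]
    [MeasurableSpace A] [MeasurableSingletonClass A] (m : Measure S) {φ : S → S'}
    (hφ : Measurable φ) {f : S' → A} (hf : Measurable f) :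
    shannonEntropy (m.map φ) f = shannonEntropy m fun s => f (φ s) := by
  unfold shannonEntropy
  refine Finset.sum_congr rfl fun a _ => ?_
  rw [map_measureReal_apply hφ (hf (measurableSet_singleton a))]
  rfl

theorem limsup_ofReal_div_le {H H' : ℕ → ℝ} {K : ℝ}
    (h : ∀ n : ℕ, 1 ≤ n → H n ≤ H' n + n * K) :
    limsup (fun n : ℕ => ENNReal.ofReal (H n / n)) atTop ≤
      limsup (fun n : ℕ => ENNReal.ofReal (H' n / n)) atTop + ENNReal.ofReal K := by
  calc limsup (fun n : ℕ => ENNReal.ofReal (H n / n)) atTop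
      ≤ limsup (fun n : ℕ => ENNReal.ofReal (H' n / n) + ENNReal.ofReal K) atTop := by
        refine limsup_le_limsup ?_
        filter_upwards [eventually_ge_atTop 1] with n hn
        have hn0 : (0 : ℝ) < n := by exact_mod_cast hn
        refine (ENNReal.ofReal_le_ofReal ?_).trans ENNReal.ofReal_add_le
        rw [div_le_iff₀ hn0, add_mul, div_mul_cancel₀ _ hn0.ne']
        linarith [h n hn]
    _ = limsup (fun n : ℕ => ENNReal.ofReal (H' n / n)) atTop + ENNReal.ofReal K :=
        limsup_add_const (R := ℝ≥0∞) atTop (fun n : ℕ => ENNReal.ofReal (H' n / n))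
          (ENNReal.ofReal K) isBounded_le_of_top isCobounded_le_of_bot

theorem measurable_word {S A : Type*} [MeasurableSpace S] [MeasurableSpace A] {T : S → S} (hT : Measurable T) {f : S → A} (hf : Measurable f) (n : ℕ) :
    Measurable fun x (i : Fin n) => f (T^[i] x) :=
  measurable_pi_lambda _ fun i => hf.comp (hT.iterate i)

section

variable {S A : Type*} [MeasurableSpace S] [Fintype A] [MeasurableSpace A]
  [MeasurableSingletonClass A]

theorem partitionEntropy_comp_iterate {μ : Measure S} {T : S → S} (hT : MeasurePreserving T μ μ)
    {f : S → A} (hf : Measurable f) (j : ℕ) :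
    partitionEntropy μ T (fun x => f (T^[j] x)) = partitionEntropy μ T f := by
  unfold partitionEntropy
  congr 1
  ext n
  congr 2
  conv_rhs => rw [← (hT.iterate j).map_eq]
  rw [shannonEntropy_map μ (hT.measurable.iterate j) (measurable_word hT.measurable hf n)]
  simp_rw [← Function.iterate_add_apply, add_comm]

/-- The `f`-word and the `g`-word of a point are already coupled, and by invariance they differ at
each time with the same probability, at most `η`. -/
theorem partitionEntropy_le_add {μ : Measure S} [IsProbabilityMeasure μ] {T : S → S}
    (hT : MeasurePreserving T μ μ) {f g : S → A} (hf : Measurable f) (hg : Measurable g)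
    {c η : ℝ} (hc : 0 ≤ c) (hη : μ.real {x | f x ≠ g x} ≤ η) :
    partitionEntropy μ T f ≤ partitionEntropy μ T g +
      ENNReal.ofReal (noiseCost (Fintype.card A) c + c * η) := by
  refine limsup_ofReal_div_le fun n _ => ?_
  refine (shannonEntropy_le_add μ (measurable_word hT.measurable hf n)
    (measurable_word hT.measurable hg n) c).trans ?_
  have hset : MeasurableSet {x | f x ≠ g x} := by
    have := (hf.prodMk hg) (Set.toFinite {q : A × A | q.1 ≠ q.2}).measurableSet
    exact this
  have : ∀ i : Fin n, μ.real {x | f (T^[i] x) ≠ g (T^[i] x)} ≤ η := fun i => by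
    have := (hT.iterate i).measureReal_preimage hset.nullMeasurableSet
    exact this.trans_le hη
  have h2 := mul_le_mul_of_nonneg_left (Finset.sum_le_sum fun i (_ : i ∈ Finset.univ) => this i) hc
  simp only [Finset.sum_const, Finset.card_univ, Fintype.card_fin, nsmul_eq_mul] at h2
  linarith

end

/-! ### The shift and approximation by cylinders -/

theorem shift_iterate_apply {B : Type*} (i : ℕ) (x : ℤ → B) (n : ℤ) :
    shift^[i] x n = x (n + i) := by
  induction i generalizing n with
  | zero => simp
  | succ i ih =>
    rw [Function.iterate_succ_apply', shift, ih]
    push_cast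
    congr 1
    ring

section

variable {B : Type*} [MeasurableSpace B]

theorem measurable_shift : Measurable (shift : (ℤ → B) → ℤ → B) :=
  measurable_pi_lambda _ fun n => measurable_pi_apply (n + 1)

theorem IsStationary.measurable_path {Ω : Type*} [MeasurableSpace Ω] {P : Measure Ω}
    {X : ℤ → Ω → B} (hX : IsStationary P X) : Measurable fun ω n => X n ω :=
  measurable_pi_lambda _ hX.1

theorem IsStationary.measurePreserving_shift {Ω : Type*} [MeasurableSpace Ω] {P : Measure Ω}
    {X : ℤ → Ω → B} (hX : IsStationary P X) :
    MeasurePreserving shift (law P X) (law P X) := by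
  refine ⟨measurable_shift, ?_⟩
  conv_rhs => rw [← hX.2 1]
  unfold law
  rw [Measure.map_map measurable_shift hX.measurable_path]
  rfl

/-- The partition of the path space given by a labelling of the words at the times `1, …, M`. -/
def wordPartition {A : Type*} {M : ℕ} (g : (Fin M → B) → A) (x : ℤ → B) : A :=
  g fun i => x ((i : ℤ) + 1)

/-- The labelling of the words of length `M` inside a word of length `n + M`. -/
def slidingCode {A : Type*} {M : ℕ} (g : (Fin M → B) → A) (n : ℕ) (y : Fin (n + M) → B)
    (i : Fin n) : A :=
  g fun j => y ⟨i + j, by omega⟩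

theorem exists_coordinates_of_mem_measurableCylinders {C : Set (ℤ → B)}
    (hC : C ∈ measurableCylinders fun _ : ℤ => B) :
    ∃ m : ℕ, ∀ x y : ℤ → B, (∀ r : ℤ, |r| ≤ m → x r = y r) → (x ∈ C ↔ y ∈ C) := by
  obtain ⟨s, S, -, rfl⟩ := (mem_measurableCylinders C).1 hC
  refine ⟨s.sup Int.natAbs, fun x y hxy => ?_⟩
  rw [mem_cylinder, mem_cylinder]
  have : s.restrict x = s.restrict y := by
    ext ⟨r, hr⟩
    refine hxy r ?_
    have := Finset.le_sup (f := Int.natAbs) hr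
    rw [Int.abs_eq_natAbs]
    exact_mod_cast this
  rw [this]

open Classical in
/-- Finite partitions of the path space are approximated by partitions into cylinders. -/
theorem exists_wordPartition_approx {μ : Measure (ℤ → B)} [IsProbabilityMeasure μ]
    (hμ : MeasurePreserving shift μ μ) {k : ℕ} {f : (ℤ → B) → Fin k} (hf : Measurable f)
    {η : ℝ} (hη : 0 < η) :
    ∃ (j M : ℕ) (g : (Fin M → B) → Fin k),
      μ.real {x | f (shift^[j] x) ≠ wordPartition g x} ≤ η := by
  have hk : 0 < k := by
    obtain ⟨x⟩ := μ.nonempty_of_neZero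
    exact (f x).pos
  have hdense := Measure.MeasureDense.of_generateFrom_isSetAlgebra_finite μ
    (isSetAlgebra_measurableCylinders (α := fun _ : ℤ => B)) generateFrom_measurableCylinders.symm
  have hfa : ∀ a, MeasurableSet (f ⁻¹' {a}) := fun a => hf (measurableSet_singleton a)
  choose C hC hCμ using fun a => hdense.approx (f ⁻¹' {a}) (hfa a) (measure_ne_top _ _) (η / k)
    (by positivity)
  choose r hr using fun a => exists_coordinates_of_mem_measurableCylinders (hC a)
  set m := Finset.univ.sup r with hm
  have hmr : ∀ a, r a ≤ m := fun a => Finset.le_sup (Finset.mem_univ a)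
  -- The approximating cylinders need not be disjoint or cover the space. Off `D` exactly one of
  -- them contains the point, so the arbitrary choices in `G` do not matter.
  let G : Set (Fin k) → Fin k := fun s => if h : s.Nonempty then h.some else ⟨0, hk⟩
  -- The word is placed at the times `-m, …, m`; other coordinates do not affect the `C a`. As
  -- `wordPartition` reads from time 1, the matching shift is by `m + 1`.
  let e : (Fin (2 * m + 1) → B) → ℤ → B := fun y t =>
    if h : 0 ≤ t + m ∧ t + m < 2 * m + 1 then y ⟨(t + m).toNat, by omega⟩ else y 0
  refine ⟨m + 1, 2 * m + 1, fun y => G {a | e y ∈ C a}, ?_⟩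
  set D : Set (ℤ → B) := ⋃ a, symmDiff (f ⁻¹' {a}) (C a) with hD
  have hDm : MeasurableSet D :=
    MeasurableSet.iUnion fun a => (hfa a).symmDiff (hdense.measurable _ (hC a))
  have hsub : {x | f (shift^[m + 1] x) ≠ wordPartition (fun y => G {a | e y ∈ C a}) x} ⊆
      shift^[m + 1] ⁻¹' D := by
    intro x hx
    by_contra hxD
    apply hx
    set z := shift^[m + 1] x with hz
    have hzC : ∀ a, z ∈ C a ↔ f z = a := by
      intro a
      by_contra hne
      refine hxD (Set.mem_iUnion.2 ⟨a, ?_⟩)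
      rw [Set.mem_symmDiff, Set.mem_preimage, Set.mem_singleton_iff]
      tauto
    have he : ∀ a, e (fun i => x ((i : ℤ) + 1)) ∈ C a ↔ f z = a := by
      intro a
      rw [← hzC]
      refine hr a _ _ fun t ht => ?_
      have htm : |t| ≤ m := ht.trans (by exact_mod_cast hmr a)
      rw [abs_le] at htm
      rw [hz, shift_iterate_apply]
      have h : 0 ≤ t + m ∧ t + m < 2 * m + 1 := by omega
      simp only [e, dif_pos h]
      congr 1
      push_cast
      omega
    have hs : {a | e (fun i => x ((i : ℤ) + 1)) ∈ C a} = {f z} := by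
      ext a
      rw [Set.mem_ofPred_eq, he, Set.mem_singleton_iff, eq_comm]
    have hne : ({f z} : Set (Fin k)).Nonempty := Set.singleton_nonempty _
    simp only [wordPartition, hs, G, dif_pos hne]
    exact hne.some_mem.symm
  calc μ.real {x | f (shift^[m + 1] x) ≠ wordPartition (fun y => G {a | e y ∈ C a}) x}
      ≤ μ.real (shift^[m + 1] ⁻¹' D) := measureReal_mono hsub
    _ = μ.real D := (hμ.iterate _).measureReal_preimage hDm.nullMeasurableSet
    _ ≤ ∑ a, μ.real (symmDiff (f ⁻¹' {a}) (C a)) := measureReal_iUnion_fintype_le _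
    _ ≤ ∑ _a : Fin k, η / k := Finset.sum_le_sum fun a _ =>
        ENNReal.toReal_le_of_le_ofReal (by positivity) (hCμ a).le
    _ = η := by
        have : (k : ℝ) ≠ 0 := by exact_mod_cast hk.ne'
        simp
        field_simp

end

/-! ### Word partitions and `dbar` -/

theorem lintegral_hamming {B : Type*} [Countable B] [MeasurableSpace B]
    [DiscreteMeasurableSpace B] {N : ℕ} (m : Measure ((Fin N → B) × (Fin N → B))) :
    ∫⁻ q, hamming q.1 q.2 ∂m = (∑ l, m {q | q.1 l ≠ q.2 l}) / N := by
  classical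
  have h : ∀ q : (Fin N → B) × (Fin N → B), hamming q.1 q.2 =
      (N : ℝ≥0∞)⁻¹ * ∑ l, Set.indicator {q : (Fin N → B) × (Fin N → B) | q.1 l ≠ q.2 l} 1 q := by
    intro q
    rw [hamming, ENNReal.div_eq_inv_mul, hammingDist, Finset.card_filter]
    push_cast
    congr 1
    refine Finset.sum_congr rfl fun l _ => ?_
    simp [Set.indicator_apply]
  simp_rw [h]
  rw [lintegral_const_mul _ .of_discrete, lintegral_finsetSum _ fun l _ => .of_discrete,
    ENNReal.div_eq_inv_mul]
  congr 1
  exact Finset.sum_congr rfl fun l _ => lintegral_indicator_one .of_discrete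

theorem shannonEntropy_slidingCode {B A : Type*} [Countable B] [MeasurableSpace B]
    [DiscreteMeasurableSpace B] [Fintype A] [MeasurableSpace A] [MeasurableSingletonClass A]
    {Ω : Type*} [MeasurableSpace Ω] {P : Measure Ω} {X : ℤ → Ω → B} (hX : IsStationary P X)
    {M : ℕ} (g : (Fin M → B) → A) (n : ℕ) :
    shannonEntropy (blockLaw P X (n + M)) (slidingCode g n) =
      shannonEntropy (law P X) fun x (i : Fin n) => wordPartition g (shift^[i] x) := by
  have hg : Measurable (wordPartition g : (ℤ → B) → A) :=
    (Measurable.of_discrete (f := g)).comp (measurable_pi_lambda _ fun i => measurable_pi_apply _)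
  rw [law, shannonEntropy_map P hX.measurable_path (measurable_word measurable_shift hg n),
    blockLaw, shannonEntropy_map P (measurable_pi_lambda _ fun i => hX.1 _) .of_discrete]
  congr 1
  ext ω i
  simp only [slidingCode, wordPartition, shift_iterate_apply]
  congr 1
  ext j
  congr 1
  push_cast
  ring

/-- Two labels can differ only if their windows differ somewhere, and each position lies in at most
`M` windows. -/
theorem sum_slidingCode_ne_le {B A : Type*} [MeasurableSpace B] {M n : ℕ} (g : (Fin M → B) → A)
    (m : Measure ((Fin (n + M) → B) × (Fin (n + M) → B))) [IsFiniteMeasure m] :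
    ∑ i, m.real {q | slidingCode g n q.1 i ≠ slidingCode g n q.2 i} ≤
      M * ∑ l, m.real {q | q.1 l ≠ q.2 l} := by
  have h1 : ∀ i : Fin n, m.real {q | slidingCode g n q.1 i ≠ slidingCode g n q.2 i} ≤
      ∑ j : Fin M, m.real {q | q.1 ⟨i + j, by omega⟩ ≠ q.2 ⟨i + j, by omega⟩} := by
    intro i
    refine (measureReal_mono ?_).trans (measureReal_iUnion_fintype_le _)
    intro q hq
    by_contra hne
    simp only [Set.mem_iUnion, Set.mem_ofPred_eq, not_exists, not_not] at hne
    exact hq (congrArg g (funext hne))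
  have h2 : ∀ j : Fin M, ∑ i : Fin n,
      m.real {q | q.1 ⟨i + j, by omega⟩ ≠ q.2 ⟨i + j, by omega⟩} ≤
        ∑ l, m.real {q | q.1 l ≠ q.2 l} := by
    intro j
    let φ : Fin n ↪ Fin (n + M) := ⟨fun i => ⟨i + j, by omega⟩, fun a b h => by
      simpa [Fin.ext_iff] using h⟩
    calc _ = ∑ l ∈ Finset.univ.map φ, m.real {q | q.1 l ≠ q.2 l} := by
          rw [Finset.sum_map]; rfl
      _ ≤ _ := Finset.sum_le_sum_of_subset_of_nonneg (Finset.subset_univ _)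
          fun _ _ _ => measureReal_nonneg
  calc _ ≤ ∑ i : Fin n, ∑ j : Fin M,
        m.real {q | q.1 ⟨i + j, by omega⟩ ≠ q.2 ⟨i + j, by omega⟩} :=
        Finset.sum_le_sum fun i _ => h1 i
    _ = ∑ j : Fin M, ∑ i : Fin n,
        m.real {q | q.1 ⟨i + j, by omega⟩ ≠ q.2 ⟨i + j, by omega⟩} := Finset.sum_comm
    _ ≤ ∑ _j : Fin M, ∑ l, m.real {q | q.1 l ≠ q.2 l} := Finset.sum_le_sum fun j _ => h2 j
    _ = _ := by simp

/-- The entropy of a partition into cylinders is continuous with respect to `d̄`. -/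
theorem partitionEntropy_wordPartition_le_of_dbar_lt {B A : Type*} [Countable B]
    [MeasurableSpace B] [DiscreteMeasurableSpace B] [Fintype A] [MeasurableSpace A]
    [MeasurableSingletonClass A] {Ω Ω' : Type*} [MeasurableSpace Ω] [MeasurableSpace Ω']
    {P : Measure Ω} [IsProbabilityMeasure P] {P' : Measure Ω'} {X : ℤ → Ω → B} {Y : ℤ → Ω' → B}
    (hX : IsStationary P X) (hY : IsStationary P' Y) {δ : ℝ} (hd : dbar P X P' Y < ENNReal.ofReal δ)
    {M : ℕ} (g : (Fin M → B) → A) {c : ℝ} (hc : 0 ≤ c) :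
    partitionEntropy (law P X) shift (wordPartition g) ≤
      partitionEntropy (law P' Y) shift (wordPartition g) +
        ENNReal.ofReal (noiseCost (Fintype.card A) c + c * (M * (M + 1) * δ)) := by
  have hδ : 0 < δ := ENNReal.ofReal_pos.1 (bot_le.trans_lt hd)
  refine limsup_ofReal_div_le fun n hn => ?_
  have hN : 1 ≤ n + M := by omega
  have hblock : dbarBlock P X P' Y (n + M) < ENNReal.ofReal δ :=
    (le_iSup₂_of_le (n + M) hN le_rfl : _ ≤ dbar P X P' Y).trans_lt hd
  simp only [dbarBlock, iInf_lt_iff] at hblock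
  obtain ⟨m, ⟨hm1, hm2⟩, hm⟩ := hblock
  have hm0 : IsProbabilityMeasure m := by
    have : IsProbabilityMeasure (m.map Prod.fst) := by
      rw [hm1]
      exact Measure.isProbabilityMeasure_map (measurable_pi_lambda _ fun i => hX.1 _).aemeasurable
    exact Measure.isProbabilityMeasure_of_map Prod.fst
  rw [lintegral_hamming] at hm
  have hmis : ∑ l, m.real {q | q.1 l ≠ q.2 l} ≤ (n + M) * δ := by
    have hN0 : ((n + M : ℕ) : ℝ≥0∞) ≠ 0 := by exact_mod_cast (by omega : n + M ≠ 0)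
    have h1 := (ENNReal.div_le_iff hN0 (ENNReal.natCast_ne_top _)).1 hm.le
    have h2 := ENNReal.toReal_mono (ENNReal.mul_ne_top ENNReal.ofReal_ne_top
      (ENNReal.natCast_ne_top _)) h1
    rw [ENNReal.toReal_sum fun l _ => measure_ne_top _ _, ENNReal.toReal_mul,
      ENNReal.toReal_ofReal hδ.le, ENNReal.toReal_natCast, mul_comm δ] at h2
    exact_mod_cast h2
  have hcode : Measurable (slidingCode g n) := .of_discrete
  have hmain := shannonEntropy_le_add m (hcode.comp measurable_fst) (hcode.comp measurable_snd) c
  have e1 : shannonEntropy m (slidingCode g n ∘ Prod.fst) =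
      shannonEntropy (law P X) fun x (i : Fin n) => wordPartition g (shift^[i] x) := by
    rw [← shannonEntropy_slidingCode hX, ← hm1, shannonEntropy_map m measurable_fst hcode]
    rfl
  have e2 : shannonEntropy m (slidingCode g n ∘ Prod.snd) =
      shannonEntropy (law P' Y) fun x (i : Fin n) => wordPartition g (shift^[i] x) := by
    rw [← shannonEntropy_slidingCode hY, ← hm2, shannonEntropy_map m measurable_snd hcode]
    rfl
  rw [e1, e2] at hmain
  refine hmain.trans ?_
  have h3 : ∑ i, m.real {q | slidingCode g n q.1 i ≠ slidingCode g n q.2 i} ≤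
      n * (M * (M + 1) * δ) := by
    have hn1 : (1 : ℝ) ≤ n := by exact_mod_cast hn
    have hM : (0 : ℝ) ≤ M := M.cast_nonneg
    calc _ ≤ M * ∑ l, m.real {q | q.1 l ≠ q.2 l} := sum_slidingCode_ne_le g m
      _ ≤ M * ((n + M) * δ) := mul_le_mul_of_nonneg_left hmis hM
      -- `n + M ≤ n * (M + 1)` for `n ≥ 1` makes the bound linear in `n`.
      _ ≤ M * ((n * (M + 1)) * δ) := by
          gcongr
          nlinarith
      _ = _ := by ring
  have h4 := mul_le_mul_of_nonneg_left h3 hc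
  simp only [Function.comp_apply]
  linarith

end StationaryProcess

/-! ### Lower semicontinuity of the entropy -/

theorem mainTheorem3 {B : Type*} [Countable B] [MeasurableSpace B]
    [DiscreteMeasurableSpace B] {Ω : Type*} [MeasurableSpace Ω] (P : Measure Ω)
    [IsProbabilityMeasure P] (ξ : ℤ → Ω → B) (hξ : StationaryProcess.IsStationary P ξ)
    (hfin : StationaryProcess.entropy P ξ < ∞) (ε : ℝ) (hε : 0 < ε) :
    ∃ δ : ℝ, 0 < δ ∧
      ∀ (Ω' : Type*) [MeasurableSpace Ω'] (P' : Measure Ω') [IsProbabilityMeasure P']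
        (ζ : ℤ → Ω' → B), StationaryProcess.IsStationary P' ζ →
        StationaryProcess.dbar P ξ P' ζ < ENNReal.ofReal δ →
        (StationaryProcess.entropy P ξ : EReal) - (ε : EReal) <
          (StationaryProcess.entropy P' ζ : EReal) := by
  open StationaryProcess in
  have hprob : IsProbabilityMeasure (law P ξ) :=
    Measure.isProbabilityMeasure_map hξ.measurable_path.aemeasurable
  have hT := hξ.measurePreserving_shift
  obtain ⟨k, f, hf, hkf⟩ : ∃ (k : ℕ) (f : (ℤ → B) → Fin k), Measurable f ∧
      entropy P ξ ≤ partitionEntropy (law P ξ) shift f + ENNReal.ofReal (ε / 4) := by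
    rcases eq_or_ne (entropy P ξ) 0 with h0 | h0
    · exact ⟨1, fun _ => 0, measurable_const, by simp [h0]⟩
    · have hlt : entropy P ξ - ENNReal.ofReal (ε / 4) < entropy P ξ :=
        ENNReal.sub_lt_self hfin.ne h0 (ENNReal.ofReal_pos.2 (by positivity)).ne'
      obtain ⟨k, hk⟩ := lt_iSup_iff.1 hlt
      obtain ⟨f, hk⟩ := lt_iSup_iff.1 hk
      obtain ⟨hf, hk⟩ := lt_iSup_iff.1 hk
      exact ⟨k, f, hf, tsub_le_iff_right.1 hk.le⟩
  obtain ⟨c, hc, hck⟩ : ∃ c : ℝ, 0 < c ∧ noiseCost k c < ε / 8 :=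
    ((eventually_gt_atTop 0).and
      ((tendsto_noiseCost k).eventually (gt_mem_nhds (by positivity)))).exists
  obtain ⟨j, M, g, hg⟩ := exists_wordPartition_approx hT hf (show 0 < ε / 8 / c by positivity)
  have hgm : Measurable (wordPartition g : (ℤ → B) → Fin k) :=
    (Measurable.of_discrete (f := g)).comp (measurable_pi_lambda _ fun i => measurable_pi_apply _)
  have hfg := partitionEntropy_le_add hT (hf.comp (measurable_shift.iterate j)) hgm hc.le hg
  rw [Function.comp_def, partitionEntropy_comp_iterate hT hf j, Fintype.card_fin,
    mul_div_cancel₀ _ hc.ne'] at hfg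
  -- This gives `c * (M * (M + 1) * δ) ≤ ε / 8`; the extra `+ 1` covers `M = 0`. Each of the three
  -- approximations then costs at most `ε / 4`, which leaves room for the strict inequality.
  refine ⟨ε / 8 / (c * (M * (M + 1) + 1)), by positivity, fun Ω' _ P' _ ζ hζ hd => ?_⟩
  have hgg := partitionEntropy_wordPartition_le_of_dbar_lt hξ hζ hd g hc.le
  rw [Fintype.card_fin] at hgg
  have hle : partitionEntropy (law P' ζ) shift (wordPartition g) ≤ entropy P' ζ :=
    le_iSup_of_le k (le_iSup_of_le _ (le_iSup_of_le hgm le_rfl))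
  have hb1 : noiseCost k c + ε / 8 ≤ ε / 4 := by linarith
  have hb2 : noiseCost k c + c * (M * (M + 1) * (ε / 8 / (c * (M * (M + 1) + 1)))) ≤ ε / 4 := by
    have : c * (M * (M + 1) * (ε / 8 / (c * (M * (M + 1) + 1)))) =
        (M * (M + 1) : ℝ) / (M * (M + 1) + 1) * (ε / 8) := by
      field_simp
    have h1 : (M * (M + 1) : ℝ) / (M * (M + 1) + 1) ≤ 1 :=
      (div_le_one (by positivity)).2 (by linarith)
    have h2 := mul_le_mul_of_nonneg_right h1 (show 0 ≤ ε / 8 by positivity)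
    linarith
  have htot : entropy P ξ ≤ entropy P' ζ + ENNReal.ofReal (3 * (ε / 4)) := by
    have h3 : ENNReal.ofReal (3 * (ε / 4)) =
        ENNReal.ofReal (ε / 4) + ENNReal.ofReal (ε / 4) + ENNReal.ofReal (ε / 4) := by
      rw [← ENNReal.ofReal_add, ← ENNReal.ofReal_add] <;> first | positivity | (congr 1; ring)
    calc entropy P ξ ≤ partitionEntropy (law P ξ) shift f + ENNReal.ofReal (ε / 4) := hkf
      _ ≤ (partitionEntropy (law P ξ) shift (wordPartition g) + ENNReal.ofReal (ε / 4)) +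
          ENNReal.ofReal (ε / 4) := by
          gcongr
          exact hfg.trans (by gcongr)
      _ ≤ (entropy P' ζ + ENNReal.ofReal (ε / 4) + ENNReal.ofReal (ε / 4)) +
          ENNReal.ofReal (ε / 4) := by
          gcongr
          exact hgg.trans (by gcongr)
      _ = _ := by rw [h3]; ring
  rcases eq_or_ne (entropy P' ζ) ∞ with htop | htop
  · rw [htop]
    lift entropy P ξ to NNReal using hfin.ne with a
    exact lt_of_lt_of_eq (EReal.coe_lt_top ((a : ℝ) - ε)) (by simp)
  · have hreal := ENNReal.toReal_mono (ENNReal.add_ne_top.2 ⟨htop, ENNReal.ofReal_ne_top⟩) htot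
    rw [ENNReal.toReal_add htop ENNReal.ofReal_ne_top,
      ENNReal.toReal_ofReal (by positivity)] at hreal
    rw [← ENNReal.ofReal_toReal hfin.ne, ← ENNReal.ofReal_toReal htop, EReal.coe_ennreal_ofReal,
      EReal.coe_ennreal_ofReal, max_eq_left ENNReal.toReal_nonneg, max_eq_left ENNReal.toReal_nonneg,
      ← EReal.coe_sub, EReal.coe_lt_coe_iff]
    linarith
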